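/- Throughout, $\|\cdot\|$ is the spectral norm and $\|\cdot\|_F$ the Frobenius norm, $\mathbb{O}_{d,r}$ is the set of real $d\times r$ matrices with orthonormal columns, $\mathbb{O}_r=\mathbb{O}_{r,r}$, and $\mathrm{dist}(U,V)=\|(I-UU^{\top})V\|$ for $U,V\in\mathbb{O}_{d,r}$. For a symmetric matrix $A\in\mathbb{R}^{d\times d}$ let $\lambda_1(A)\ge\dots\ge\lambda_d(A)$ be its eigenvalues, and for $1\le r<d$ let $\delta_r(A)=\lambda_r(A)-\lambda_{r+1}(A)$. A principal $r$-dimensional eigenspace of $A$ is the span of orthonormal vectors $u_1,\dots,u_r$ with $Au_k=\lambda_k(A)u_k$. Lemma. There is an absolute constant $C>0$ (independent of all dimensions and all data) such that the following holds. Let $1\le r<d$, let $A\in\mathbb{R}^{d\times d}$ be symmetric with $\delta_r(A)\ge\delta>0$, and let the columns of $V\in\mathbb{O}_{d,r}$ span the principal $r$-dimensional eigenspace of $A$. Let $\mathcal{I}_{\mathrm{good}}\subseteq\{1,\dots,m\}$ and, for each $i\in\mathcal{I}_{\mathrm{good}}$, let $A_i\in\mathbb{R}^{d\times d}$ be symmetric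 and let the columns of $V_i\in\mathbb{O}_{d,r}$ span a principal $r$-dimensional eigenspace of $A_i$. Let $V_{\mathrm{ref}}\in\mathbb{O}_{d,r}$ satisfy $\mathrm{dist}(V_{\mathrm{ref}},V)=\varepsilon<\delta_r(A)/8$, and suppose that the representative $V$ of its column space is aligned with $V_{\mathrm{ref}}$, that is, $$\|V_{\mathrm{ref}}-V\|_F=\min_{Z\in\mathbb{O}_r}\|V_{\mathrm{ref}}Z-V\|_F .$$ For $i\in\mathcal{I}_{\mathrm{good}}$ put $$V_i^{\mathrm{ideal}}=V_i\cdot\operatorname*{argmin}_{Z\in\mathbb{O}_r}\|V_iZ-V\|_F,\qquad V_i^{\mathrm{corr}}=V_i\cdot\operatorname*{argmin}_{Z\in\mathbb{O}_r}\|V_iZ-V_{\mathrm{ref}}\|_F ,$$ with any choice of the minimizers. Then, for every $i\in\mathcal{I}_{\mathrm{good}}$, $$\bigl\|V_i^{\mathrm{ideal}}-V_i^{\mathrm{corr}}\bigr\|\le \frac{C}{\delta^{2}}\,\max\bigl\{\|A_i-A\|^2,\ \|A\|^2\varepsilon^2\bigr\}.$$ -/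

import Mathlib

open scoped Matrix Matrix.Norms.L2Operator

/- Inside this file and the statement, `‖M‖` on a real matrix is the spectral norm
`sup_{‖x‖₂ = 1} ‖M x‖₂` (Mathlib's `L2` operator norm). -/

namespace RobustEigenspace

/-- `𝕆_{d,r}`: the columns of the `d × r` matrix `V` are orthonormal. For `d = r` this is the
orthogonal group `𝕆_r`. -/
def OrthonormalCols {d r : ℕ} (V : Matrix (Fin d) (Fin r) ℝ) : Prop :=
  Vᵀ * V = 1

/-- The Frobenius norm. -/
noncomputable def frobNorm {d r : ℕ} (M : Matrix (Fin d) (Fin r) ℝ) : ℝ :=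
  Real.sqrt (∑ i, ∑ j, M i j ^ 2)

/-- The subspace distance `‖(I - U Uᵀ) V‖` of matrices with orthonormal columns. -/
noncomputable def subspaceDist {d r : ℕ} (U V : Matrix (Fin d) (Fin r) ℝ) : ℝ :=
  ‖(1 - U * Uᵀ) * V‖

/-- The eigenvalues, with multiplicity, of a real symmetric matrix in nonincreasing order.
The index starts at `0`: `sortedEigenvalue hA k` is `λ_{k+1}(A)`. -/
noncomputable def sortedEigenvalue {d : ℕ} {A : Matrix (Fin d) (Fin d) ℝ}
    (hA : A.IsHermitian) (k : Fin d) : ℝ :=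
  hA.eigenvalues₀ (Fin.cast (Fintype.card_fin d).symm k)

/-- The eigengap `δ_r(A) = λ_r(A) - λ_{r+1}(A)`, for `1 ≤ r < d`. -/
noncomputable def eigengap {d : ℕ} {A : Matrix (Fin d) (Fin d) ℝ} (hA : A.IsHermitian)
    (r : ℕ) (hr : 1 ≤ r) (hrd : r < d) : ℝ :=
  sortedEigenvalue hA ⟨r - 1, by omega⟩ - sortedEigenvalue hA ⟨r, hrd⟩

/-- `V` has orthonormal columns that span a principal `r`-dimensional eigenspace of the symmetric
matrix `A`, that is, the span of an orthonormal family `u_1, …, u_r` (the columns of `U`) with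
`A u_k = λ_k(A) u_k`. (The space is unique as soon as `λ_r(A) > λ_{r+1}(A)`.) -/
def IsPrincipal {d r : ℕ} (hrd : r ≤ d) {A : Matrix (Fin d) (Fin d) ℝ} (hA : A.IsHermitian)
    (V : Matrix (Fin d) (Fin r) ℝ) : Prop :=
  OrthonormalCols V ∧
    ∃ U : Matrix (Fin d) (Fin r) ℝ, OrthonormalCols U ∧
      (∀ k : Fin r, A *ᵥ U.col k = sortedEigenvalue hA (Fin.castLE hrd k) • U.col k) ∧
      Submodule.span ℝ (Set.range V.col) = Submodule.span ℝ (Set.range U.col)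

/-- `Z` is a solution of the orthogonal Procrustes problem
`argmin_{Z ∈ 𝕆_r} ‖Y Z - Y_ref‖_F`. -/
def IsProcrustes {d r : ℕ} (Y Yref : Matrix (Fin d) (Fin r) ℝ)
    (Z : Matrix (Fin r) (Fin r) ℝ) : Prop :=
  OrthonormalCols Z ∧
    ∀ Z' : Matrix (Fin r) (Fin r) ℝ, OrthonormalCols Z' →
      frobNorm (Y * Z - Yref) ≤ frobNorm (Y * Z' - Yref)

end RobustEigenspace

/-! Write `Y` for `V_i` and `W` for `V_ref`. A Procrustes rotation `Z` from `Y` to `V` is an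
orthogonal polar factor: `Yᵀ * V = Z * K` with `K` symmetric and positive semidefinite. Since `‖1 -
K‖ ≤ ‖1 - K²‖` and the latter is the squared subspace distance, `Z` agrees with `Yᵀ * V` to second
order (`IsProcrustes.norm_gram_sub_le`).

Comparing the two rotations thus reduces to comparing `Yᵀ * V` with `Yᵀ * W`. Split `W` along the
column space of `V`. The parallel part contributes `Yᵀ * V * (1 - Vᵀ * W)`, of second order because
`V` is aligned with `W`; the orthogonal part contributes a product of two first-order residuals.
This gives the quadratic bound `norm_procrustes_sub_le`.

Finally `davis_kahan`, which needs no gap for `A_i`, bounds the distance from `V` to `V_i` by `2‖A_i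
- A‖/δ`, and `δ ≤ 2‖A‖` absorbs the bare `ε²` into the maximum. -/

namespace RobustEigenspace

open Matrix

/-! ### Spectral norm via dot products -/

section Norm

variable {m n l : ℕ}

theorem norm_toLp_sq (x : Fin n → ℝ) : ‖WithLp.toLp 2 x‖ ^ 2 = x ⬝ᵥ x := by
  rw [EuclideanSpace.norm_sq_eq]
  simp [dotProduct, sq]

theorem dotProduct_self_nonneg' (x : Fin n → ℝ) : 0 ≤ x ⬝ᵥ x := by
  rw [← norm_toLp_sq]; positivity

theorem norm_toLp_mulVec_le (M : Matrix (Fin m) (Fin n) ℝ) (x : Fin n → ℝ) :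
    ‖WithLp.toLp 2 (M *ᵥ x)‖ ≤ ‖M‖ * ‖WithLp.toLp 2 x‖ :=
  M.l2_opNorm_mulVec (WithLp.toLp 2 x)

theorem dotProduct_mulVec_self_le (M : Matrix (Fin m) (Fin n) ℝ) (x : Fin n → ℝ) :
    (M *ᵥ x) ⬝ᵥ (M *ᵥ x) ≤ ‖M‖ ^ 2 * (x ⬝ᵥ x) := by
  rw [← norm_toLp_sq, ← norm_toLp_sq, ← mul_pow]
  gcongr
  exact norm_toLp_mulVec_le M x

theorem norm_le_of_dotProduct_le (M : Matrix (Fin m) (Fin n) ℝ) {c : ℝ} (hc : 0 ≤ c)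
    (h : ∀ x, (M *ᵥ x) ⬝ᵥ (M *ᵥ x) ≤ c ^ 2 * (x ⬝ᵥ x)) : ‖M‖ ≤ c := by
  rw [Matrix.l2_opNorm_def]
  refine ContinuousLinearMap.opNorm_le_bound _ hc fun x => ?_
  have h1 := h x.ofLp
  rw [← norm_toLp_sq, ← norm_toLp_sq, ← mul_pow] at h1
  exact le_of_sq_le_sq h1 (by positivity)

theorem abs_dotProduct_mulVec_le (M : Matrix (Fin m) (Fin n) ℝ) (x : Fin m → ℝ)
    (y : Fin n → ℝ) :
    |x ⬝ᵥ (M *ᵥ y)| ≤ ‖M‖ * (‖WithLp.toLp 2 x‖ * ‖WithLp.toLp 2 y‖) := by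
  have h1 := abs_real_inner_le_norm (WithLp.toLp 2 (M *ᵥ y)) (WithLp.toLp 2 x)
  rw [EuclideanSpace.inner_toLp_toLp] at h1
  calc |x ⬝ᵥ (M *ᵥ y)| ≤ ‖WithLp.toLp 2 (M *ᵥ y)‖ * ‖WithLp.toLp 2 x‖ := by simpa using h1
    _ ≤ (‖M‖ * ‖WithLp.toLp 2 y‖) * ‖WithLp.toLp 2 x‖ := by
        gcongr; exact norm_toLp_mulVec_le M y
    _ = _ := by ring

theorem abs_quadForm_le (M : Matrix (Fin n) (Fin n) ℝ) (x : Fin n → ℝ) :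
    |x ⬝ᵥ (M *ᵥ x)| ≤ ‖M‖ * (x ⬝ᵥ x) := by
  rw [← norm_toLp_sq x, sq]
  exact abs_dotProduct_mulVec_le M x x

theorem norm_transpose (M : Matrix (Fin m) (Fin n) ℝ) : ‖Mᵀ‖ = ‖M‖ := by
  rw [← conjTranspose_eq_transpose_of_trivial, l2_opNorm_conjTranspose]

theorem norm_transpose_mul_self (M : Matrix (Fin m) (Fin n) ℝ) : ‖Mᵀ * M‖ = ‖M‖ ^ 2 := by
  rw [← conjTranspose_eq_transpose_of_trivial, l2_opNorm_conjTranspose_mul_self, sq]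

theorem dotProduct_mulVec_mulVec (M : Matrix (Fin m) (Fin n) ℝ) (N : Matrix (Fin m) (Fin l) ℝ)
    (x : Fin n → ℝ) (y : Fin l → ℝ) :
    (M *ᵥ x) ⬝ᵥ (N *ᵥ y) = x ⬝ᵥ ((Mᵀ * N) *ᵥ y) := by
  rw [← mulVec_mulVec, dotProduct_mulVec x, vecMul_transpose]

/-- A right singular vector for the largest singular value. -/
theorem exists_top_singular_vector (hn : 1 ≤ n) (M : Matrix (Fin m) (Fin n) ℝ) :
    ∃ v : Fin n → ℝ, v ⬝ᵥ v = 1 ∧ (Mᵀ * M) *ᵥ v = ‖M‖ ^ 2 • v := by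
  have : Nonempty (Fin n) := ⟨⟨0, hn⟩⟩
  obtain ⟨v, hv, hmax⟩ := (isCompact_sphere (0 : EuclideanSpace ℝ (Fin n)) 1).exists_isMaxOn
    (NormedSpace.sphere_nonempty.2 zero_le_one)
    (f := fun x => ‖(toEuclideanLin M).toContinuousLinearMap x‖) (by fun_prop)
  have hv1 : ‖v‖ = 1 := by simpa using hv
  have hvv : v.ofLp ⬝ᵥ v.ofLp = 1 := by rw [← norm_toLp_sq]; simp [hv1]
  have hM : ‖M‖ ≤ ‖WithLp.toLp 2 (M *ᵥ v.ofLp)‖ := by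
    rw [Matrix.l2_opNorm_def]
    refine ContinuousLinearMap.opNorm_le_of_unit_norm (norm_nonneg _) fun x hx => ?_
    exact hmax (by simpa using hx)
  have hMv : (M *ᵥ v.ofLp) ⬝ᵥ (M *ᵥ v.ofLp) = ‖M‖ ^ 2 := by
    refine le_antisymm ?_ ?_
    · simpa [hvv] using dotProduct_mulVec_self_le M v.ofLp
    · rw [← norm_toLp_sq]; gcongr
  refine ⟨v.ofLp, hvv, ?_⟩
  -- Expanding `‖MᵀMv - ‖M‖²v‖²`, the cross term is `-2‖M‖⁴` and the other two are at most `‖M‖⁴`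
  -- each, so the difference vanishes.
  have h2 : ((Mᵀ * M) *ᵥ v.ofLp) ⬝ᵥ ((Mᵀ * M) *ᵥ v.ofLp) ≤ (‖M‖ ^ 2) ^ 2 := by
    simpa [hvv, norm_transpose_mul_self] using dotProduct_mulVec_self_le (Mᵀ * M) v.ofLp
  rw [dotProduct_mulVec_mulVec] at hMv
  rw [← sub_eq_zero, ← dotProduct_self_eq_zero]
  refine le_antisymm ?_ (dotProduct_self_nonneg' _)
  simp only [sub_dotProduct, dotProduct_sub, dotProduct_smul, smul_dotProduct, smul_eq_mul,
    dotProduct_comm _ v.ofLp, hMv]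
  nlinarith

end Norm

/-! ### Orthonormal columns and the subspace distance -/

section Orthonormal

variable {d r : ℕ}

theorem OrthonormalCols.norm_le_one {V : Matrix (Fin d) (Fin r) ℝ} (h : OrthonormalCols V) :
    ‖V‖ ≤ 1 := by
  refine norm_le_of_dotProduct_le V zero_le_one fun x => ?_
  rw [dotProduct_mulVec_mulVec, show Vᵀ * V = 1 from h]; simp

theorem OrthonormalCols.norm_transpose_le_one {V : Matrix (Fin d) (Fin r) ℝ}
    (h : OrthonormalCols V) : ‖Vᵀ‖ ≤ 1 := by
  rw [norm_transpose]; exact h.norm_le_one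

theorem OrthonormalCols.mul_transpose_self {Z : Matrix (Fin r) (Fin r) ℝ}
    (h : OrthonormalCols Z) : Z * Zᵀ = 1 :=
  mul_eq_one_comm.1 h

theorem OrthonormalCols.mul {V : Matrix (Fin d) (Fin r) ℝ} {l : ℕ} {Z : Matrix (Fin r) (Fin l) ℝ}
    (h : OrthonormalCols V) (hZ : OrthonormalCols Z) : OrthonormalCols (V * Z) := by
  unfold OrthonormalCols at *
  rw [transpose_mul, Matrix.mul_assoc, ← Matrix.mul_assoc Vᵀ, h, Matrix.one_mul, hZ]

/-- The residual of the projection onto a column space is an orthogonal projection. -/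
theorem residual_idempotent {V : Matrix (Fin d) (Fin r) ℝ} (hV : OrthonormalCols V) :
    (1 - V * Vᵀ)ᵀ * (1 - V * Vᵀ) = 1 - V * Vᵀ := by
  have h : V * Vᵀ * (V * Vᵀ) = V * Vᵀ := by
    rw [Matrix.mul_assoc, ← Matrix.mul_assoc Vᵀ, show Vᵀ * V = 1 from hV, Matrix.one_mul]
  simp [Matrix.mul_sub, Matrix.sub_mul, h]

/-- The residual of the projection onto the column space of `U` satisfies the Pythagorean
identity. -/
theorem residual_transpose_mul_self {l : ℕ} {U : Matrix (Fin d) (Fin r) ℝ}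
    {W : Matrix (Fin d) (Fin l) ℝ} (hU : OrthonormalCols U) (hW : OrthonormalCols W) :
    ((1 - U * Uᵀ) * W)ᵀ * ((1 - U * Uᵀ) * W) = 1 - (Uᵀ * W)ᵀ * (Uᵀ * W) := by
  have hW' : Wᵀ * W = 1 := hW
  rw [transpose_mul, Matrix.mul_assoc, ← Matrix.mul_assoc _ _ W, residual_idempotent hU]
  simp [Matrix.mul_sub, Matrix.sub_mul, hW', Matrix.mul_assoc]

theorem subspaceDist_sq {U V : Matrix (Fin d) (Fin r) ℝ}
    (hU : OrthonormalCols U) (hV : OrthonormalCols V) :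
    subspaceDist U V ^ 2 = ‖1 - (Uᵀ * V)ᵀ * (Uᵀ * V)‖ := by
  rw [subspaceDist, ← norm_transpose_mul_self, residual_transpose_mul_self hU hV]

theorem norm_residual_le_one {U : Matrix (Fin d) (Fin r) ℝ} (hU : OrthonormalCols U) :
    ‖(1 : Matrix (Fin d) (Fin d) ℝ) - U * Uᵀ‖ ≤ 1 := by
  refine norm_le_of_dotProduct_le _ zero_le_one fun x => ?_
  have h1 : OrthonormalCols (1 : Matrix (Fin d) (Fin d) ℝ) := by simp [OrthonormalCols]
  have h := residual_transpose_mul_self hU h1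
  simp only [Matrix.mul_one] at h
  rw [dotProduct_mulVec_mulVec, h, sub_mulVec, dotProduct_sub, ← dotProduct_mulVec_mulVec]
  have := dotProduct_self_nonneg' (Uᵀ *ᵥ x)
  simp only [one_mulVec]
  linarith

theorem subspaceDist_le_one {U V : Matrix (Fin d) (Fin r) ℝ}
    (hU : OrthonormalCols U) (hV : OrthonormalCols V) : subspaceDist U V ≤ 1 :=
  (l2_opNorm_mul _ _).trans
    (mul_le_one₀ (norm_residual_le_one hU) (norm_nonneg _) hV.norm_le_one)

end Orthonormal

/-! ### Procrustes solutions as polar factors -/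

section Procrustes

variable {d r : ℕ}

theorem frobNorm_sq (M : Matrix (Fin d) (Fin r) ℝ) : frobNorm M ^ 2 = (Mᵀ * M).trace := by
  rw [frobNorm, Real.sq_sqrt (by positivity), Finset.sum_comm]
  simp [Matrix.trace, Matrix.mul_apply, sq]

/-- Orthonormality makes the quadratic terms constant, so Procrustes minimisation is maximisation of
a trace. -/
theorem frobNorm_sub_sq {Y W : Matrix (Fin d) (Fin r) ℝ} (hY : OrthonormalCols Y)
    (hW : OrthonormalCols W) :
    frobNorm (Y - W) ^ 2 = 2 * r - 2 * (Yᵀ * W).trace := by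
  have h1 : Yᵀ * Y = 1 := hY
  have h2 : Wᵀ * W = 1 := hW
  have h3 : (Wᵀ * Y).trace = (Yᵀ * W).trace := by
    rw [← trace_transpose, transpose_mul, transpose_transpose]
  rw [frobNorm_sq]
  simp only [transpose_sub, Matrix.mul_sub, Matrix.sub_mul, h1, h2, trace_sub, trace_one, h3,
    Fintype.card_fin]
  ring

/-- Reflections and plane rotations are the only competitors needed for the trace maximum: rotations
force symmetry, reflections force positivity. -/
theorem householder_orthonormalCols {v : Fin r → ℝ} (hv : v ⬝ᵥ v = 1) :
    OrthonormalCols (1 - (2 : ℝ) • vecMulVec v v) := by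
  have h : vecMulVec v v * vecMulVec v v = vecMulVec v v := by
    rw [vecMulVec_mul_vecMulVec, hv]; simp
  simp only [OrthonormalCols, transpose_sub, transpose_one, transpose_smul, transpose_vecMulVec,
    Matrix.mul_sub, Matrix.sub_mul, Matrix.one_mul, Matrix.mul_one, Matrix.smul_mul,
    Matrix.mul_smul, h]
  module

/-- The rotation by the angle with cosine `c` and sine `s` in the coordinate plane `i`, `j`. -/
def givens (i j : Fin r) (c s : ℝ) : Matrix (Fin r) (Fin r) ℝ :=
  1 + (c - 1) • (single i i 1 + single j j 1) + s • (single i j 1 - single j i 1)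

theorem givens_orthonormalCols {i j : Fin r} (hij : i ≠ j) {c s : ℝ} (h : c ^ 2 + s ^ 2 = 1) :
    OrthonormalCols (givens i j c s) := by
  simp only [OrthonormalCols, givens, transpose_add, transpose_sub, transpose_one, transpose_smul,
    transpose_single, Matrix.mul_add, Matrix.add_mul, Matrix.mul_sub, Matrix.sub_mul,
    Matrix.one_mul, Matrix.smul_mul, Matrix.mul_smul, single_mul_single_same,
    single_mul_single_of_ne _ _ _ _ hij, single_mul_single_of_ne _ _ _ _ hij.symm, mul_one]
  match_scalars <;> first | ring1 | linear_combination h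

/-- A square matrix whose trace cannot be increased by an orthogonal factor is symmetric and
positive semidefinite. -/
theorem symm_and_nonneg_of_trace_max {K : Matrix (Fin r) (Fin r) ℝ}
    (h : ∀ Q : Matrix (Fin r) (Fin r) ℝ, OrthonormalCols Q → (Qᵀ * K).trace ≤ K.trace) :
    Kᵀ = K ∧ ∀ x, 0 ≤ x ⬝ᵥ (K *ᵥ x) := by
  constructor
  · ext i j
    rw [transpose_apply]
    by_cases hij : i = j
    · rw [hij]
    have key : ∀ c s : ℝ, c ^ 2 + s ^ 2 = 1 →
        (c - 1) * (K i i + K j j) + s * (K i j - K j i) ≤ 0 := by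
      intro c s hcs
      have h1 := h _ (givens_orthonormalCols hij hcs)
      simp only [givens, transpose_add, transpose_sub, transpose_one, transpose_smul,
        transpose_single, Matrix.add_mul, Matrix.sub_mul, Matrix.one_mul, Matrix.smul_mul,
        trace_add, trace_sub, trace_smul, smul_eq_mul, trace_single_mul] at h1
      linarith
    set a := K i i + K j j
    set b := K i j - K j i with hb
    have hn : 0 < |a| + 1 := by positivity
    have hna : 1 ≤ |a| + 1 - a := by linarith [le_abs_self a]
    -- Tangent of the half angle of the test rotation. With this choice the trace gain is `2t²(|a| +
    -- 1 - a)/(1 + t²)`, positive unless `t = 0`.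
    set t := b / (|a| + 1) with ht
    have hbt : b = t * (|a| + 1) := by rw [ht]; field_simp
    have ht1 : 0 < 1 + t ^ 2 := by positivity
    have h1 := key ((1 - t ^ 2) / (1 + t ^ 2)) (2 * t / (1 + t ^ 2)) (by field_simp; ring)
    have h2 : ((1 - t ^ 2) / (1 + t ^ 2) - 1) * a + 2 * t / (1 + t ^ 2) * b
        = 2 * t ^ 2 * (|a| + 1 - a) / (1 + t ^ 2) := by
      rw [hbt]; field_simp; ring
    rw [h2, div_le_iff₀ ht1, zero_mul] at h1
    have h3 : t ^ 2 ≤ 0 := by nlinarith [sq_nonneg t]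
    have h4 : t = 0 := by simpa using le_antisymm h3 (sq_nonneg t)
    rw [h4, zero_mul] at hbt
    linarith
  · intro x
    by_cases hx : x ⬝ᵥ x = 0
    · rw [dotProduct_self_eq_zero.1 hx]; simp
    have hx0 : 0 < x ⬝ᵥ x := lt_of_le_of_ne (dotProduct_self_nonneg' x) (Ne.symm hx)
    set t : ℝ := (Real.sqrt (x ⬝ᵥ x))⁻¹ with ht
    have ht2 : t * t * (x ⬝ᵥ x) = 1 := by
      rw [ht, ← mul_inv, Real.mul_self_sqrt hx0.le, inv_mul_cancel₀ hx]
    have hv : (t • x) ⬝ᵥ (t • x) = 1 := by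
      simp only [dotProduct_smul, smul_dotProduct, smul_eq_mul]; linarith
    -- Reflecting in the unit vector `v = t • x` changes the trace by `-2 vᵀKv`.
    have h1 := h _ (householder_orthonormalCols hv)
    have h2 : (vecMulVec (t • x) (t • x) * K).trace = t * t * (x ⬝ᵥ (K *ᵥ x)) := by
      rw [vecMulVec_mul, trace_vecMulVec, dotProduct_comm, ← dotProduct_mulVec]
      simp only [mulVec_smul, dotProduct_smul, smul_dotProduct, smul_eq_mul]; ring
    simp only [transpose_sub, transpose_one, transpose_smul, transpose_vecMulVec,
      Matrix.sub_mul, Matrix.one_mul, Matrix.smul_mul, trace_sub, trace_smul, smul_eq_mul, h2] at h1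
    have h3 : 0 < t * t := by
      by_contra hc
      nlinarith
    by_contra hc
    nlinarith [mul_pos h3 (neg_pos.2 (not_le.1 hc))]

/-- A Procrustes solution is an orthogonal polar factor. -/
theorem IsProcrustes.symm_and_nonneg {Y W : Matrix (Fin d) (Fin r) ℝ}
    {Z : Matrix (Fin r) (Fin r) ℝ} (hY : OrthonormalCols Y) (hW : OrthonormalCols W)
    (h : IsProcrustes Y W Z) :
    (Zᵀ * (Yᵀ * W))ᵀ = Zᵀ * (Yᵀ * W) ∧ ∀ x, 0 ≤ x ⬝ᵥ ((Zᵀ * (Yᵀ * W)) *ᵥ x) := by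
  refine symm_and_nonneg_of_trace_max fun Q hQ => ?_
  have h1 := pow_le_pow_left₀ (Real.sqrt_nonneg _) (h.2 (Z * Q) (h.1.mul hQ)) 2
  rw [show √_ = frobNorm (Y * Z - W) from rfl, frobNorm_sub_sq (hY.mul h.1) hW,
    frobNorm_sub_sq (hY.mul (h.1.mul hQ)) hW] at h1
  simp only [transpose_mul, Matrix.mul_assoc] at h1
  linarith

/-- With `y = (1 - K)x` one has `(1 - K²)x = y + Ky`, and `yᵀKy ≥ 0` means that adding `Ky` cannot
shorten `y`. -/
theorem norm_one_sub_le_of_nonneg {K : Matrix (Fin r) (Fin r) ℝ} (h : ∀ x, 0 ≤ x ⬝ᵥ (K *ᵥ x)) :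
    ‖1 - K‖ ≤ ‖1 - K * K‖ := by
  refine norm_le_of_dotProduct_le _ (norm_nonneg _) fun x => ?_
  refine le_trans ?_ (dotProduct_mulVec_self_le (1 - K * K) x)
  have h1 : (1 - K * K) *ᵥ x = (1 - K) *ᵥ x + K *ᵥ ((1 - K) *ᵥ x) := by
    rw [mulVec_mulVec, ← add_mulVec]; congr 1; noncomm_ring
  rw [h1]
  set y := (1 - K) *ᵥ x
  simp only [add_dotProduct, dotProduct_add, dotProduct_comm (K *ᵥ y) y]
  have := h y
  have := dotProduct_self_nonneg' (K *ᵥ y)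
  linarith

/-- A Procrustes solution agrees with the cross Gram matrix to second order in the subspace
distance. -/
theorem IsProcrustes.norm_gram_sub_le {Y W : Matrix (Fin d) (Fin r) ℝ}
    {Z : Matrix (Fin r) (Fin r) ℝ} (hY : OrthonormalCols Y) (hW : OrthonormalCols W)
    (h : IsProcrustes Y W Z) : ‖Yᵀ * W - Z‖ ≤ subspaceDist Y W ^ 2 := by
  obtain ⟨hs, hp⟩ := h.symm_and_nonneg hY hW
  have hZ := h.1.mul_transpose_self
  set K := Zᵀ * (Yᵀ * W) with hK
  have hM : Yᵀ * W = Z * K := by rw [hK, ← Matrix.mul_assoc, hZ, Matrix.one_mul]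
  have hMM : (Yᵀ * W)ᵀ * (Yᵀ * W) = K * K := by
    rw [hM, transpose_mul, hs, Matrix.mul_assoc, ← Matrix.mul_assoc Zᵀ,
      show Zᵀ * Z = 1 from h.1, Matrix.one_mul]
  rw [subspaceDist_sq hY hW, hMM, hM, show Z * K - Z = -(Z * (1 - K)) by
    rw [Matrix.mul_sub, Matrix.mul_one, neg_sub], norm_neg]
  calc ‖Z * (1 - K)‖ ≤ ‖Z‖ * ‖1 - K‖ := l2_opNorm_mul _ _
    _ ≤ 1 * ‖1 - K * K‖ := by
      gcongr
      · exact h.1.norm_le_one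
      · exact norm_one_sub_le_of_nonneg hp
    _ = _ := one_mul _

/-- The subspace distance is symmetric (for pairs whose Procrustes problem has a solution). -/
theorem IsProcrustes.subspaceDist_comm {Y W : Matrix (Fin d) (Fin r) ℝ}
    {Z : Matrix (Fin r) (Fin r) ℝ} (hY : OrthonormalCols Y) (hW : OrthonormalCols W)
    (h : IsProcrustes Y W Z) : subspaceDist Y W ≤ subspaceDist W Y := by
  obtain ⟨hs, hp⟩ := h.symm_and_nonneg hY hW
  have hZ := h.1.mul_transpose_self
  set K := Zᵀ * (Yᵀ * W) with hK
  have hZZ : Zᵀ * Z = 1 := h.1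
  have hM : Yᵀ * W = Z * K := by rw [hK, ← Matrix.mul_assoc, hZ, Matrix.one_mul]
  have hM' : Wᵀ * Y = (Z * K)ᵀ := by rw [← hM, transpose_mul, transpose_transpose]
  refine le_of_sq_le_sq ?_ (norm_nonneg _)
  rw [subspaceDist_sq hY hW, subspaceDist_sq hW hY, hM, hM']
  -- As `K` is symmetric, the two Gram products are `K²` and `ZK²Zᵀ`, which are orthogonally
  -- conjugate.
  have h1 : 1 - (Z * K)ᵀ * (Z * K) = Zᵀ * (1 - (Z * K)ᵀᵀ * (Z * K)ᵀ) * Z := by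
    rw [transpose_transpose, transpose_mul, hs, Matrix.mul_sub, Matrix.sub_mul, Matrix.mul_one, hZZ]
    congr 1
    simp only [Matrix.mul_assoc, hZZ, Matrix.mul_one]
    simp only [← Matrix.mul_assoc, hZZ, Matrix.one_mul]
  rw [h1]
  set X := 1 - (Z * K)ᵀᵀ * (Z * K)ᵀ
  calc ‖Zᵀ * X * Z‖ ≤ ‖Zᵀ‖ * ‖X‖ * ‖Z‖ :=
        (l2_opNorm_mul _ _).trans (by gcongr; exact l2_opNorm_mul _ _)
    _ ≤ 1 * ‖X‖ * 1 := by
        gcongr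
        · exact h.1.norm_transpose_le_one
        · exact h.1.norm_le_one
    _ = ‖X‖ := by ring

end Procrustes

/-! ### Ordered eigenvalues, Weyl and Davis–Kahan -/

section Spectral

variable {d r : ℕ}

theorem sortedEigenvalue_antitone {A : Matrix (Fin d) (Fin d) ℝ} (hA : A.IsHermitian) :
    Antitone (sortedEigenvalue hA) :=
  fun _ _ h => hA.eigenvalues₀_antitone h

/-- Spectral decomposition with the eigenvalues in nonincreasing order. -/
theorem exists_sorted_diagonalization {A : Matrix (Fin d) (Fin d) ℝ} (hA : A.IsHermitian) :
    ∃ B : Matrix (Fin d) (Fin d) ℝ, OrthonormalCols B ∧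
      A * B = B * diagonal (sortedEigenvalue hA) := by
  -- `eigenvalues` is `eigenvalues₀` reindexed by an unspecified equivalence; `e` undoes that
  -- reindexing.
  set e : Fin d ≃ Fin d := (finCongr (Fintype.card_fin d).symm).trans
    (Fintype.equivOfCardEq (Fintype.card_fin _))
  have he : ∀ k, hA.eigenvalues (e k) = sortedEigenvalue hA k := by
    intro k
    simp [IsHermitian.eigenvalues, sortedEigenvalue, e]
  refine ⟨of fun i k => (hA.eigenvectorBasis (e k)).ofLp i, ?_, ?_⟩
  · ext k l
    have h1 := hA.eigenvectorBasis.inner_eq_ite (e k) (e l)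
    simp only [PiLp.inner_apply, RCLike.inner_apply, conj_trivial, e.apply_eq_iff_eq] at h1
    rw [Matrix.one_apply, ← h1, Matrix.mul_apply]
    exact Finset.sum_congr rfl fun i _ => mul_comm _ _
  · ext i k
    have h1 := congrFun (hA.mulVec_eigenvectorBasis (e k)) i
    rw [he, Pi.smul_apply, smul_eq_mul, mul_comm] at h1
    rw [mul_diagonal]
    exact h1

theorem quadForm_eq_sum {A : Matrix (Fin d) (Fin d) ℝ} {U : Matrix (Fin d) (Fin r) ℝ}
    {μ : Fin r → ℝ} (hU : OrthonormalCols U) (h : A * U = U * diagonal μ) (c : Fin r → ℝ) :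
    (U *ᵥ c) ⬝ᵥ (A *ᵥ (U *ᵥ c)) = ∑ k, μ k * c k ^ 2 := by
  rw [mulVec_mulVec, h, dotProduct_mulVec_mulVec, ← Matrix.mul_assoc, show Uᵀ * U = 1 from hU,
    Matrix.one_mul]
  simp only [dotProduct, mulVec_diagonal]
  exact Finset.sum_congr rfl fun k _ => by ring

theorem OrthonormalCols.dotProduct_mulVec_self {U : Matrix (Fin d) (Fin r) ℝ}
    (hU : OrthonormalCols U) (c : Fin r → ℝ) : (U *ᵥ c) ⬝ᵥ (U *ᵥ c) = ∑ k, c k ^ 2 := by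
  rw [dotProduct_mulVec_mulVec, show Uᵀ * U = 1 from hU, one_mulVec]
  simp [dotProduct, sq]

theorem quadForm_ge {A : Matrix (Fin d) (Fin d) ℝ} {U : Matrix (Fin d) (Fin r) ℝ}
    {μ : Fin r → ℝ} (hU : OrthonormalCols U) (h : A * U = U * diagonal μ) {α : ℝ}
    (hα : ∀ k, α ≤ μ k) (c : Fin r → ℝ) :
    α * ((U *ᵥ c) ⬝ᵥ (U *ᵥ c)) ≤ (U *ᵥ c) ⬝ᵥ (A *ᵥ (U *ᵥ c)) := by
  rw [quadForm_eq_sum hU h, hU.dotProduct_mulVec_self, Finset.mul_sum]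
  exact Finset.sum_le_sum fun k _ => mul_le_mul_of_nonneg_right (hα k) (sq_nonneg _)

/-- The quadratic form on vectors without components along eigenvectors for eigenvalues
exceeding `β`. -/
theorem quadForm_le_of_forall_eq_zero {A B : Matrix (Fin d) (Fin d) ℝ} {μ : Fin d → ℝ}
    (hB : OrthonormalCols B) (h : A * B = B * diagonal μ) {β : ℝ} {x : Fin d → ℝ}
    (hx : ∀ k, β < μ k → (Bᵀ *ᵥ x) k = 0) : x ⬝ᵥ (A *ᵥ x) ≤ β * (x ⬝ᵥ x) := by
  have hxB : B *ᵥ (Bᵀ *ᵥ x) = x := by rw [mulVec_mulVec, hB.mul_transpose_self, one_mulVec]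
  have h1 := quadForm_eq_sum hB h (Bᵀ *ᵥ x)
  have h2 := hB.dotProduct_mulVec_self (Bᵀ *ᵥ x)
  rw [hxB] at h1 h2
  rw [h1, h2, Finset.mul_sum]
  refine Finset.sum_le_sum fun k _ => ?_
  by_cases hk : β < μ k
  · simp [hx k hk]
  · exact mul_le_mul_of_nonneg_right (not_lt.1 hk) (sq_nonneg _)

theorem abs_sortedEigenvalue_le {A : Matrix (Fin d) (Fin d) ℝ} (hA : A.IsHermitian) (k : Fin d) :
    |sortedEigenvalue hA k| ≤ ‖A‖ := by
  obtain ⟨B, hB, hAB⟩ := exists_sorted_diagonalization hA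
  have h1 := abs_quadForm_le A (B *ᵥ Pi.single k 1)
  rw [quadForm_eq_sum hB hAB, hB.dotProduct_mulVec_self] at h1
  simpa [Pi.single_apply] using h1

theorem eigengap_le {A : Matrix (Fin d) (Fin d) ℝ} (hA : A.IsHermitian) (hr : 1 ≤ r)
    (hrd : r < d) : eigengap hA r hr hrd ≤ 2 * ‖A‖ := by
  have h1 := le_abs_self (sortedEigenvalue hA ⟨r - 1, by omega⟩)
  have h2 := neg_abs_le (sortedEigenvalue hA ⟨r, hrd⟩)
  have h3 := abs_sortedEigenvalue_le hA ⟨r - 1, by omega⟩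
  have h4 := abs_sortedEigenvalue_le hA ⟨r, hrd⟩
  rw [eigengap]
  linarith

/-- Weyl's inequality: if the quadratic form of `A` is at least `α` on the column space of the
`d × r` matrix `U`, then `λ_r(A') ≥ α - ‖A' - A‖`. -/
theorem weyl_lower_bound {A A' : Matrix (Fin d) (Fin d) ℝ} (hA' : A'.IsHermitian)
    (hr : 1 ≤ r) (hrd : r ≤ d) {U : Matrix (Fin d) (Fin r) ℝ} (hU : OrthonormalCols U) {α : ℝ}
    (hα : ∀ c, α * ((U *ᵥ c) ⬝ᵥ (U *ᵥ c)) ≤ (U *ᵥ c) ⬝ᵥ (A *ᵥ (U *ᵥ c))) :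
    α - ‖A' - A‖ ≤ sortedEigenvalue hA' ⟨r - 1, by omega⟩ := by
  obtain ⟨B, hB, hAB⟩ := exists_sorted_diagonalization hA'
  set β := sortedEigenvalue hA' ⟨r - 1, by omega⟩ with hβ
  -- Only `r - 1` linear conditions on `r` coefficients: some nonzero vector in the column space of
  -- `U` is orthogonal to the top `r - 1` eigenvectors of `A'`.
  let f : Fin (r - 1) → Fin d := Fin.castLE (by omega)
  obtain ⟨c, hc, hc0⟩ := Submodule.exists_mem_ne_zero_of_ne_bot
    (LinearMap.ker_ne_bot_of_finrank_lt (f := (((Bᵀ * U).submatrix f id).mulVecLin))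
      (by simp; omega))
  set x := U *ᵥ c with hx
  have hxx : 0 < x ⬝ᵥ x := by
    refine lt_of_le_of_ne (dotProduct_self_nonneg' x) fun h0 => hc0 ?_
    rw [hx, dotProduct_mulVec_mulVec, show Uᵀ * U = 1 from hU, one_mulVec] at h0
    exact dotProduct_self_eq_zero.1 h0.symm
  have h1 : x ⬝ᵥ (A' *ᵥ x) ≤ β * (x ⬝ᵥ x) := by
    refine quadForm_le_of_forall_eq_zero hB hAB fun k hk => ?_
    have hkr : (k : ℕ) < r - 1 := by
      by_contra hkr
      exact absurd (sortedEigenvalue_antitone hA' (show ⟨r - 1, by omega⟩ ≤ k from not_lt.1 hkr))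
        (not_le.2 hk)
    have h2 := congrFun (LinearMap.mem_ker.1 hc) ⟨k, hkr⟩
    rw [hx, mulVec_mulVec]
    exact h2
  have h3 := hα c
  have h4 := (abs_le.1 (abs_quadForm_le (A' - A) x)).1
  rw [sub_mulVec, dotProduct_sub] at h4
  have h5 : (α - ‖A' - A‖) * (x ⬝ᵥ x) ≤ β * (x ⬝ᵥ x) := by linarith
  exact le_of_mul_le_mul_right h5 hxx

/-- Under a strict gap `β`, the quadratic form is at most `β` on the orthogonal complement of a
principal eigenspace. -/
theorem quadForm_le_on_complement {A : Matrix (Fin d) (Fin d) ℝ} (hA : A.IsHermitian)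
    (hrd : r < d) {U : Matrix (Fin d) (Fin r) ℝ} (hU : OrthonormalCols U)
    (hAU : A * U = U * diagonal fun k => sortedEigenvalue hA (Fin.castLE hrd.le k))
    (hgap : ∀ k : Fin r, sortedEigenvalue hA ⟨r, hrd⟩ < sortedEigenvalue hA (Fin.castLE hrd.le k))
    {x : Fin d → ℝ} (hx : Uᵀ *ᵥ x = 0) :
    x ⬝ᵥ (A *ᵥ x) ≤ sortedEigenvalue hA ⟨r, hrd⟩ * (x ⬝ᵥ x) := by
  obtain ⟨B, hB, hAB⟩ := exists_sorted_diagonalization hA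
  refine quadForm_le_of_forall_eq_zero hB hAB ?_
  have hAt : Aᵀ = A := by rw [← conjTranspose_eq_transpose_of_trivial]; exact hA
  have hcomm : (diagonal (sortedEigenvalue hA)) * (Bᵀ * U) = (Bᵀ * U) *
      diagonal fun k => sortedEigenvalue hA (Fin.castLE hrd.le k) := by
    have h1 := congrArg transpose hAB
    rw [transpose_mul, transpose_mul, hAt, diagonal_transpose] at h1
    rw [← Matrix.mul_assoc, ← h1, Matrix.mul_assoc, hAU, Matrix.mul_assoc]
  -- Eigenvectors for distinct eigenvalues are orthogonal, and the gap separates indices below `r`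
  -- from the rest.
  have hzero : ∀ (j : Fin d) (k : Fin r), r ≤ (j : ℕ) → (Bᵀ * U) j k = 0 := by
    intro j k hj
    have h1 := congrFun (congrFun hcomm j) k
    rw [diagonal_mul, mul_diagonal] at h1
    have h2 := sortedEigenvalue_antitone hA (show (⟨r, hrd⟩ : Fin d) ≤ j from hj)
    have h3 := hgap k
    have h4 : (sortedEigenvalue hA j - sortedEigenvalue hA (Fin.castLE hrd.le k)) *
        (Bᵀ * U) j k = 0 := by linarith
    exact (mul_eq_zero.1 h4).resolve_left (by linarith)
  -- The surviving block of `Bᵀ * U` is square and orthogonal, hence invertible; so `Uᵀ *ᵥ x = 0`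
  -- kills the first `r` coordinates of `Bᵀ *ᵥ x`.
  set W : Matrix (Fin r) (Fin r) ℝ := (Bᵀ * U).submatrix (Fin.castLE hrd.le) id with hW
  have hsum : ∀ g : Fin d → ℝ, (∀ j : Fin d, r ≤ (j : ℕ) → g j = 0) →
      ∑ j, g j = ∑ k : Fin r, g (Fin.castLE hrd.le k) := by
    intro g hg
    symm
    refine Finset.sum_of_injOn (Fin.castLE hrd.le) (Fin.castLE_injective _).injOn (by simp) ?_
      (by simp)
    intro j _ hj
    refine hg j (not_lt.1 fun hlt => hj ?_)
    exact ⟨⟨j, hlt⟩, by simp, by ext; simp⟩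
  have hWo : OrthonormalCols W := by
    have h1 : (Bᵀ * U)ᵀ * (Bᵀ * U) = 1 := by
      rw [transpose_mul, transpose_transpose, Matrix.mul_assoc, ← Matrix.mul_assoc B,
        hB.mul_transpose_self, Matrix.one_mul]
      exact hU
    ext k l
    rw [← h1, Matrix.mul_apply, Matrix.mul_apply, hsum]
    · rfl
    · intro j hj
      rw [hzero j l hj, mul_zero]
  have hWx : Wᵀ *ᵥ (fun k => (Bᵀ *ᵥ x) (Fin.castLE hrd.le k)) = 0 := by
    rw [← hx]
    have h1 : Uᵀ *ᵥ x = (Bᵀ * U)ᵀ *ᵥ (Bᵀ *ᵥ x) := by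
      rw [transpose_mul, transpose_transpose, mulVec_mulVec, Matrix.mul_assoc,
        hB.mul_transpose_self, Matrix.mul_one]
    rw [h1]
    ext k
    rw [mulVec, mulVec, dotProduct, dotProduct, hsum]
    · rfl
    · intro j hj
      rw [transpose_apply, hzero j k hj, zero_mul]
  have hy : (fun k => (Bᵀ *ᵥ x) (Fin.castLE hrd.le k)) = 0 := by
    rw [← one_mulVec (fun k => (Bᵀ *ᵥ x) (Fin.castLE hrd.le k)), ← hWo.mul_transpose_self,
      ← mulVec_mulVec, hWx, mulVec_zero]
  intro j hj
  have hjr : (j : ℕ) < r := by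
    by_contra hjr
    exact absurd (sortedEigenvalue_antitone hA (show ⟨r, hrd⟩ ≤ j from not_lt.1 hjr))
      (not_le.2 hj)
  exact congrFun hy ⟨j, hjr⟩

/-- Two orthonormal bases of one space differ by an orthogonal factor, so `V` may be traded for a
basis of eigenvectors. -/
theorem IsPrincipal.exists_eq_mul {A : Matrix (Fin d) (Fin d) ℝ} {hA : A.IsHermitian}
    {hrd : r ≤ d} {V : Matrix (Fin d) (Fin r) ℝ} (h : IsPrincipal hrd hA V) :
    ∃ (U : Matrix (Fin d) (Fin r) ℝ) (W : Matrix (Fin r) (Fin r) ℝ), OrthonormalCols U ∧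
      OrthonormalCols W ∧
      A * U = U * diagonal (fun k => sortedEigenvalue hA (Fin.castLE hrd k)) ∧ V = U * W := by
  obtain ⟨hV, U, hU, hAU, hspan⟩ := h
  have h1 : ∀ j, ∃ c, U *ᵥ c = V.col j := by
    intro j
    have h2 : V.col j ∈ LinearMap.range U.mulVecLin := by
      rw [Matrix.range_mulVecLin, ← hspan]
      exact Submodule.subset_span ⟨j, rfl⟩
    exact h2
  choose c hc using h1
  have hVU : V = U * (of c)ᵀ := by
    ext i j
    exact (congrFun (hc j) i).symm
  refine ⟨U, (of c)ᵀ, hU, ?_, ?_, hVU⟩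
  · have h2 : Vᵀ * V = 1 := hV
    rw [hVU, transpose_mul, Matrix.mul_assoc, ← Matrix.mul_assoc Uᵀ, show Uᵀ * U = 1 from hU,
      Matrix.one_mul] at h2
    exact h2
  · ext i k
    rw [mul_diagonal, mul_comm]
    exact congrFun (hAU k) i

/-- The Davis–Kahan `sin Θ` bound for a one-sided gap: `X` solves a Sylvester equation whose
coefficients have separated numerical ranges. -/
theorem norm_le_of_sylvester (hr : 1 ≤ r) {X R : Matrix (Fin d) (Fin r) ℝ}
    {A : Matrix (Fin d) (Fin d) ℝ} {Λ : Matrix (Fin r) (Fin r) ℝ} {α β : ℝ} (hαβ : β < α)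
    (hR : X * Λ - A * X = R) (hΛ : ∀ v, α * (v ⬝ᵥ v) ≤ v ⬝ᵥ (Λ *ᵥ v))
    (hAX : ∀ v, (X *ᵥ v) ⬝ᵥ (A *ᵥ (X *ᵥ v)) ≤ β * ((X *ᵥ v) ⬝ᵥ (X *ᵥ v))) :
    ‖X‖ ≤ ‖R‖ / (α - β) := by
  obtain ⟨v, hv, hXv⟩ := exists_top_singular_vector hr X
  have hn : (X *ᵥ v) ⬝ᵥ (X *ᵥ v) = ‖X‖ ^ 2 := by
    rw [dotProduct_mulVec_mulVec, hXv, dotProduct_smul, hv, smul_eq_mul, mul_one]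
  have h1 : (X *ᵥ v) ⬝ᵥ (R *ᵥ v) = ‖X‖ ^ 2 * (v ⬝ᵥ (Λ *ᵥ v)) -
      (X *ᵥ v) ⬝ᵥ (A *ᵥ (X *ᵥ v)) := by
    rw [← hR, sub_mulVec, dotProduct_sub, ← mulVec_mulVec, ← mulVec_mulVec]
    congr 1
    -- Moving `XᵀX` onto its eigenvector `v` turns it into the scalar `‖X‖²`, leaving the quadratic
    -- form of `Λ` at `v`.
    rw [dotProduct_mulVec_mulVec X X, dotProduct_mulVec v (Xᵀ * X), ← mulVec_transpose,
      transpose_mul, transpose_transpose, hXv, smul_dotProduct, smul_eq_mul]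
  have h2 := le_abs_self ((X *ᵥ v) ⬝ᵥ (R *ᵥ v))
  have h3 := abs_dotProduct_mulVec_le R (X *ᵥ v) v
  have h4 : ‖WithLp.toLp 2 v‖ = 1 := by
    have := norm_toLp_sq v
    rw [hv] at this
    exact (sq_eq_sq₀ (norm_nonneg _) zero_le_one).1 (by rw [this, one_pow])
  have h5 : ‖WithLp.toLp 2 (X *ᵥ v)‖ = ‖X‖ := by
    have := norm_toLp_sq (X *ᵥ v)
    rw [hn] at this
    exact (sq_eq_sq₀ (norm_nonneg _) (norm_nonneg _)).1 this
  rw [h4, h5, mul_one] at h3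
  have h6 := hΛ v
  have h7 := hAX v
  rw [hv, mul_one] at h6
  rw [hn] at h7
  have h8 := mul_le_mul_of_nonneg_left h6 (sq_nonneg ‖X‖)
  rw [le_div_iff₀ (by linarith)]
  have h9 : ‖X‖ * (‖X‖ * (α - β)) ≤ ‖X‖ * ‖R‖ := by nlinarith
  rcases (norm_nonneg X).eq_or_lt with h0 | h0
  · rw [← h0, zero_mul]; exact norm_nonneg _
  · exact le_of_mul_le_mul_left h9 h0

/-- Davis–Kahan with a gap assumption on only one of the two matrices. -/
theorem davis_kahan {A A' : Matrix (Fin d) (Fin d) ℝ} (hA : A.IsHermitian) (hA' : A'.IsHermitian)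
    (hr : 1 ≤ r) (hrd : r < d) {V V' : Matrix (Fin d) (Fin r) ℝ} {δ : ℝ} (hδ : 0 < δ)
    (hgap : δ ≤ eigengap hA r hr hrd) (hV : IsPrincipal hrd.le hA V)
    (hV' : IsPrincipal hrd.le hA' V') :
    subspaceDist V V' ≤ 2 * ‖A' - A‖ / δ := by
  -- A large perturbation makes the bound trivial. Otherwise Weyl gives `λ_r(A') - λ_{r+1}(A) ≥ δ -
  -- ‖A' - A‖ ≥ δ/2`, whence the factor 2 and no gap needed for `A'`.
  by_cases hE : δ ≤ 2 * ‖A' - A‖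
  · exact (subspaceDist_le_one hV.1 hV'.1).trans ((one_le_div hδ).2 hE)
  rw [not_le] at hE
  rw [eigengap] at hgap
  obtain ⟨U, W, hU, hW, hAU, rfl⟩ := hV.exists_eq_mul
  obtain ⟨U', W', hU', hW', hAU', rfl⟩ := hV'.exists_eq_mul
  set α := sortedEigenvalue hA ⟨r - 1, by omega⟩
  set β := sortedEigenvalue hA ⟨r, hrd⟩
  set α' := sortedEigenvalue hA' ⟨r - 1, by omega⟩
  have hα : ∀ k : Fin r, α ≤ sortedEigenvalue hA (Fin.castLE hrd.le k) := fun k =>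
    sortedEigenvalue_antitone hA (Fin.mk_le_mk.2 (by have := k.2; simp; omega))
  have hα' : ∀ k : Fin r, α' ≤ sortedEigenvalue hA' (Fin.castLE hrd.le k) := fun k =>
    sortedEigenvalue_antitone hA' (Fin.mk_le_mk.2 (by have := k.2; simp; omega))
  have hweyl : α - ‖A' - A‖ ≤ α' := weyl_lower_bound hA' hr hrd.le hU (quadForm_ge hU hAU hα)
  have hsep : δ / 2 ≤ α' - β := by linarith
  set Q : Matrix (Fin d) (Fin d) ℝ := 1 - U * Uᵀ with hQ
  have hAt : Aᵀ = A := by rw [← conjTranspose_eq_transpose_of_trivial]; exact hA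
  have hQA : Q * A = A * Q := by
    have h1 := congrArg transpose hAU
    rw [transpose_mul, transpose_mul, hAt, diagonal_transpose] at h1
    rw [hQ, Matrix.sub_mul, Matrix.mul_sub, Matrix.one_mul, Matrix.mul_one, Matrix.mul_assoc, h1,
      ← Matrix.mul_assoc, ← Matrix.mul_assoc, hAU]
  have hUQ : Uᵀ * Q = 0 := by
    rw [hQ, Matrix.mul_sub, ← Matrix.mul_assoc, show Uᵀ * U = 1 from hU, Matrix.one_mul,
      Matrix.mul_one, sub_self]
  have hsyl : (Q * U') * diagonal (fun k => sortedEigenvalue hA' (Fin.castLE hrd.le k)) -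
      A * (Q * U') = Q * (A' - A) * U' := by
    rw [Matrix.mul_assoc, ← hAU', ← Matrix.mul_assoc A, ← hQA, Matrix.mul_sub Q,
      Matrix.sub_mul (Q * A'), Matrix.mul_assoc Q A']
  have hX : ‖Q * U'‖ ≤ ‖Q * (A' - A) * U'‖ / (α' - β) := by
    refine norm_le_of_sylvester hr (by linarith) hsyl ?_ ?_
    · intro v
      simp only [dotProduct, mulVec_diagonal, Finset.mul_sum]
      refine Finset.sum_le_sum fun k _ => ?_
      have := mul_le_mul_of_nonneg_right (hα' k) (mul_self_nonneg (v k))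
      linarith
    · intro v
      refine quadForm_le_on_complement hA hrd hU hAU (fun k => ?_) ?_
      · have := hα k
        linarith
      · rw [mulVec_mulVec, ← Matrix.mul_assoc, hUQ, Matrix.zero_mul, zero_mulVec]
  have hR : ‖Q * (A' - A) * U'‖ ≤ ‖A' - A‖ := by
    calc ‖Q * (A' - A) * U'‖ ≤ ‖Q‖ * ‖A' - A‖ * ‖U'‖ :=
          (l2_opNorm_mul _ _).trans (by gcongr; exact l2_opNorm_mul _ _)
      _ ≤ 1 * ‖A' - A‖ * 1 := by
          gcongr
          · exact norm_residual_le_one hU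
          · exact hU'.norm_le_one
      _ = _ := by ring
  -- The projection depends only on the column space.
  have hP : U * W * (U * W)ᵀ = U * Uᵀ := by
    rw [transpose_mul, Matrix.mul_assoc, ← Matrix.mul_assoc W, hW.mul_transpose_self,
      Matrix.one_mul]
  rw [subspaceDist, hP, ← hQ, ← Matrix.mul_assoc]
  calc ‖Q * U' * W'‖ ≤ ‖Q * U'‖ * ‖W'‖ := l2_opNorm_mul _ _
    _ ≤ ‖Q * U'‖ * 1 := by gcongr; exact hW'.norm_le_one
    _ ≤ ‖A' - A‖ / (δ / 2) := by
        rw [mul_one]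
        refine hX.trans ?_
        gcongr
    _ = _ := by field_simp

/-! ### Second-order comparison of the two alignments -/

theorem norm_mul_le_of_le {l m n : ℕ} {M : Matrix (Fin l) (Fin m) ℝ} {N : Matrix (Fin m) (Fin n) ℝ}
    {a b : ℝ} (hM : ‖M‖ ≤ a) (hN : ‖N‖ ≤ b) : ‖M * N‖ ≤ a * b :=
  (l2_opNorm_mul M N).trans
    (mul_le_mul hM hN (norm_nonneg _) ((norm_nonneg _).trans hM))

theorem subspaceDist_triangle {Y V W : Matrix (Fin d) (Fin r) ℝ} (hY : OrthonormalCols Y)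
    (hV : OrthonormalCols V) (hW : OrthonormalCols W) :
    subspaceDist Y W ≤ subspaceDist Y V + subspaceDist V W := by
  have h1 : (1 - Y * Yᵀ) * W = (1 - Y * Yᵀ) * V * (Vᵀ * W) +
      (1 - Y * Yᵀ) * ((1 - V * Vᵀ) * W) := by
    rw [Matrix.mul_assoc, ← Matrix.mul_add, Matrix.sub_mul 1 (V * Vᵀ), Matrix.one_mul,
      Matrix.mul_assoc V, add_sub_cancel]
  have h2 : ‖Vᵀ * W‖ ≤ 1 := by
    simpa using norm_mul_le_of_le hV.norm_transpose_le_one hW.norm_le_one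
  have h3 := norm_mul_le_of_le (le_refl ‖(1 - Y * Yᵀ) * V‖) h2
  have h4 := norm_mul_le_of_le (norm_residual_le_one hY) (le_refl ‖(1 - V * Vᵀ) * W‖)
  rw [mul_one] at h3
  rw [one_mul] at h4
  rw [subspaceDist, h1]
  exact (norm_add_le _ _).trans (add_le_add h3 h4)

/-- The residual projection is symmetric and idempotent, so it can be applied to both factors; this
makes the term quadratic. -/
theorem norm_cross_residual_le {Y V W : Matrix (Fin d) (Fin r) ℝ} (hV : OrthonormalCols V) :
    ‖Yᵀ * ((1 - V * Vᵀ) * W)‖ ≤ subspaceDist V Y * subspaceDist V W := by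
  have h1 : Yᵀ * ((1 - V * Vᵀ) * W) = ((1 - V * Vᵀ) * Y)ᵀ * ((1 - V * Vᵀ) * W) := by
    rw [transpose_mul, Matrix.mul_assoc, ← Matrix.mul_assoc (1 - V * Vᵀ)ᵀ,
      residual_idempotent hV]
  rw [h1]
  exact norm_mul_le_of_le (norm_transpose _).le le_rfl

/-- Perturbation of Procrustes solutions: aligning with `V` or with an aligned reference `W`
differs to second order in the subspace distances. -/
theorem norm_procrustes_sub_le {Y V W : Matrix (Fin d) (Fin r) ℝ} (hY : OrthonormalCols Y)
    (hV : OrthonormalCols V) (hW : OrthonormalCols W) (hWV : IsProcrustes W V 1)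
    {Z₁ Z₂ : Matrix (Fin r) (Fin r) ℝ} (h₁ : IsProcrustes Y V Z₁) (h₂ : IsProcrustes Y W Z₂) :
    ‖Z₁ - Z₂‖ ≤ 4 * (subspaceDist V Y ^ 2 + subspaceDist W V ^ 2) := by
  have hYV : subspaceDist Y V ≤ subspaceDist V Y := h₁.subspaceDist_comm hY hV
  have hsymm : Vᵀ * W = Wᵀ * V := by
    have := (hWV.symm_and_nonneg hW hV).1
    simpa using this
  have hVW : subspaceDist V W = subspaceDist W V := by
    refine (sq_eq_sq₀ (norm_nonneg _) (norm_nonneg _)).1 ?_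
    change subspaceDist V W ^ 2 = subspaceDist W V ^ 2
    rw [subspaceDist_sq hV hW, subspaceDist_sq hW hV, hsymm]
  have hgram : ‖1 - Vᵀ * W‖ ≤ subspaceDist W V ^ 2 := by
    rw [hsymm, norm_sub_rev]
    exact hWV.norm_gram_sub_le hW hV
  have hYW := subspaceDist_triangle hY hV hW
  have hcross : ‖Yᵀ * ((1 - V * Vᵀ) * W)‖ ≤ _ := norm_cross_residual_le hV
  have hYVn : ‖Yᵀ * V‖ ≤ 1 := by
    simpa using norm_mul_le_of_le hY.norm_transpose_le_one hV.norm_le_one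
  have h5 := norm_mul_le_of_le hYVn hgram
  have hdecomp : Z₁ - Z₂ = (Yᵀ * W - Z₂) - (Yᵀ * V - Z₁) +
      (Yᵀ * V * (1 - Vᵀ * W) - Yᵀ * ((1 - V * Vᵀ) * W)) := by
    rw [Matrix.mul_sub, Matrix.sub_mul, Matrix.one_mul, Matrix.mul_one, Matrix.mul_sub]
    simp only [Matrix.mul_assoc]
    abel
  have h1 := h₁.norm_gram_sub_le hY hV
  have h2 := h₂.norm_gram_sub_le hY hW
  have h6 := norm_add_le ((Yᵀ * W - Z₂) - (Yᵀ * V - Z₁))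
    (Yᵀ * V * (1 - Vᵀ * W) - Yᵀ * ((1 - V * Vᵀ) * W))
  rw [← hdecomp] at h6
  have h7 := norm_sub_le (Yᵀ * V * (1 - Vᵀ * W)) (Yᵀ * ((1 - V * Vᵀ) * W))
  have h8 := norm_sub_le (Yᵀ * W - Z₂) (Yᵀ * V - Z₁)
  have hYV0 : 0 ≤ subspaceDist Y V := norm_nonneg _
  have hYW0 : 0 ≤ subspaceDist Y W := norm_nonneg _
  rw [hVW] at hYW hcross
  set a := subspaceDist V Y
  set ε := subspaceDist W V
  have h3 : subspaceDist Y V ^ 2 ≤ a ^ 2 := pow_le_pow_left₀ hYV0 hYV 2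
  have h4 : subspaceDist Y W ^ 2 ≤ (a + ε) ^ 2 :=
    pow_le_pow_left₀ hYW0 (hYW.trans (by linarith)) 2
  -- The four errors are `a²`, `(a + ε)²`, `ε²` and `aε`; together they stay below `4(a² + ε²)`.
  have h9 : (a + ε) ^ 2 + a * ε ≤ 3 * (a ^ 2 + ε ^ 2) := by
    linarith [sq_nonneg (a - ε), sq_nonneg a, sq_nonneg ε, add_sq a ε, sub_sq a ε]
  linarith

end Spectral

end RobustEigenspace

/-! ### The main bound -/

theorem mainTheorem8 :
    ∃ C : ℝ, 0 < C ∧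
      ∀ (d r m : ℕ) (hr : 1 ≤ r) (hrd : r < d)
        (A : Matrix (Fin d) (Fin d) ℝ) (hA : A.IsHermitian)
        (V Vref : Matrix (Fin d) (Fin r) ℝ)
        (Igood : Finset (Fin m))
        (As : Fin m → Matrix (Fin d) (Fin d) ℝ)
        (hAs : ∀ i ∈ Igood, (As i).IsHermitian)
        (Vs : Fin m → Matrix (Fin d) (Fin r) ℝ)
        (δ ε : ℝ),
        0 < δ →
        δ ≤ RobustEigenspace.eigengap hA r hr hrd →
        RobustEigenspace.IsPrincipal hrd.le hA V →
        (∀ (i : Fin m) (hi : i ∈ Igood),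
          RobustEigenspace.IsPrincipal hrd.le (hAs i hi) (Vs i)) →
        RobustEigenspace.OrthonormalCols Vref →
        -- `V` is the representative of its column space that is aligned with `Vref`
        RobustEigenspace.IsProcrustes Vref V 1 →
        RobustEigenspace.subspaceDist Vref V = ε →
        ε < RobustEigenspace.eigengap hA r hr hrd / 8 →
        ∀ i ∈ Igood, ∀ Zideal Zcorr : Matrix (Fin r) (Fin r) ℝ,
          RobustEigenspace.IsProcrustes (Vs i) V Zideal →
          RobustEigenspace.IsProcrustes (Vs i) Vref Zcorr →
          ‖Vs i * Zideal - Vs i * Zcorr‖ ≤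
            C * (1 / δ ^ 2 * max (‖As i - A‖ ^ 2) (‖A‖ ^ 2 * ε ^ 2)) := by
  -- `32 = 4 * (4 + 4)`: the factor 4 of `norm_procrustes_sub_le`, and `2²` from each of `2‖A_i -
  -- A‖/δ` and `2‖A‖/δ`.
  refine ⟨32, by norm_num, ?_⟩
  intro d r m hr hrd A hA V Vref Igood As hAs Vs δ ε hδ hgap hV hVs hVref halign hε _ i hi
    Zideal Zcorr hideal hcorr
  have hVi := hVs i hi
  have hdk := RobustEigenspace.davis_kahan hA (hAs i hi) hr hrd hδ hgap hV hVi
  have hnorm : δ ≤ 2 * ‖A‖ := hgap.trans (RobustEigenspace.eigengap_le hA hr hrd)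
  have hpert := RobustEigenspace.norm_procrustes_sub_le hVi.1 hV.1 hVref halign hideal hcorr
  rw [hε] at hpert
  have ha2 := pow_le_pow_left₀ (norm_nonneg _) hdk 2
  have hε2 : ε ^ 2 ≤ (2 * ‖A‖ / δ) ^ 2 * ε ^ 2 :=
    le_mul_of_one_le_left (sq_nonneg ε) (one_le_pow₀ ((one_le_div hδ).2 hnorm))
  set T := max (‖As i - A‖ ^ 2) (‖A‖ ^ 2 * ε ^ 2) with hT
  have h1 : (2 * ‖As i - A‖ / δ) ^ 2 ≤ 4 * (1 / δ ^ 2 * T) := by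
    calc (2 * ‖As i - A‖ / δ) ^ 2 = 4 * (1 / δ ^ 2 * ‖As i - A‖ ^ 2) := by ring
      _ ≤ _ := by gcongr; exact le_max_left _ _
  have h2 : (2 * ‖A‖ / δ) ^ 2 * ε ^ 2 ≤ 4 * (1 / δ ^ 2 * T) := by
    calc (2 * ‖A‖ / δ) ^ 2 * ε ^ 2 = 4 * (1 / δ ^ 2 * (‖A‖ ^ 2 * ε ^ 2)) := by ring
      _ ≤ _ := by gcongr; exact le_max_right _ _
  calc ‖Vs i * Zideal - Vs i * Zcorr‖ = ‖Vs i * (Zideal - Zcorr)‖ := by rw [Matrix.mul_sub]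
    _ ≤ ‖Vs i‖ * ‖Zideal - Zcorr‖ := Matrix.l2_opNorm_mul _ _
    _ ≤ 1 * ‖Zideal - Zcorr‖ := by gcongr; exact hVi.1.norm_le_one
    _ ≤ 32 * (1 / δ ^ 2 * T) := by
        rw [one_mul]
        change RobustEigenspace.subspaceDist V (Vs i) ^ 2 ≤ _ at ha2
        linarith
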